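/- Let $M$ be a smooth $n$-dimensional manifold (Hausdorff and paracompact, without boundary), let $p:E\to M$ be a smooth real vector bundle of rank $2m+1$ $(m\ge 0)$, and let $(E,\rho_E,[\cdot,\cdot]_E)$ be a Lie algebroid: $\rho_E:E\to TM$ is a smooth vector bundle morphism over the identity and $[\cdot,\cdot]_E$ is a real Lie bracket on the space $\Gamma(E)$ of smooth sections with $[s_1,fs_2]_E=f[s_1,s_2]_E+\rho_E(s_1)(f)s_2$ for all $s_1,s_2\in\Gamma(E)$ and $f\in C^\infty(M)$. An *almost contact structure* on the Lie algebroid is a triple $(F_E,\xi,\eta)$ of smooth sections $F_E\in\Gamma(E\otimes E^*)$, $\xi\in\Gamma(E)$, $\eta\in\Gamma(E^*)$ with $$F_E^2=-I_E+\eta\otimes\xi,\qquad \eta(\xi)=1 .$$ For a subgroup $G\subseteq GL(2m+1,\mathbb R)$, *the structure group of $E$ reduces to $G$* if $M$ has an open cover $\{U_\alpha\}$ with smooth frames of $E$ over each $U_\alpha$, such that at every point of $U_\alpha\cap U_\beta$ the change-of-frame matrix between the frames over $U_\alpha$ and $U_\beta$ lies in $G$. Finally, $$U(m)\times 1=\left\{\begin{pmatrix}A&-B&0\\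 B&A&0\\ 0&0&1\end{pmatrix} : A,B\in M_m(\mathbb R),\ A+iB\in U(m)\right\}\subset GL(2m+1,\mathbb R).$$ **Theorem 2.2.** If the Lie algebroid $(E,\rho_E,[\cdot,\cdot]_E)$ has an almost contact structure, then the structure group of the vector bundle $E$ reduces to $U(m)\times 1$. Conversely, if the structure group of the vector bundle $E$ reduces to $U(m)\times 1$, then the Lie algebroid $(E,\rho_E,[\cdot,\cdot]_E)$ has an almost contact structure. -/

import Mathlib

open scoped Manifold ContDiff Bundle

noncomputable section

namespace LieAlgd

section Bundles

variable {n : ℕ} {M : Type*} [TopologicalSpace M] [ChartedSpace (EuclideanSpace ℝ (Fin n)) M]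
  (F : Type*) [NormedAddCommGroup F] [NormedSpace ℝ F]
  (E : M → Type*) [TopologicalSpace (Bundle.TotalSpace F E)]
  [∀ x, AddCommGroup (E x)] [∀ x, Module ℝ (E x)] [∀ x, TopologicalSpace (E x)]
  [FiberBundle F E] [VectorBundle ℝ F E]

/-- `Γ(E)`, the space of smooth global sections of the vector bundle `E → M` with typical
fibre `F`. -/
abbrev Sec : Type _ := Cₛ^∞⟮𝓡 n; F, E⟯

variable {F E} in
/-- The product `f s` of a smooth function and a smooth section. -/
def funSMul (f : C^∞⟮𝓡 n, M; ℝ⟯) (s : Sec (n := n) F E) : Sec (n := n) F E :=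
  ⟨fun x ↦ f x • s x, f.contMDiff.smul_section s.contMDiff⟩

/-- The derivative `v(f)` of a smooth function along a tangent vector `v` at `x`. -/
def dirDeriv (f : C^∞⟮𝓡 n, M; ℝ⟯) (x : M) (v : TangentSpace (𝓡 n) x) : ℝ :=
  mfderiv (𝓡 n) 𝓘(ℝ, ℝ) f x v

/-- A Lie algebroid structure on `E → M`: a vector bundle morphism `ρ : E → TM` over the identity
(given as a smooth section of the bundle `Hom(E, TM)`) and a real Lie bracket on `Γ(E)`, such that
`[s₁, f s₂] = f [s₁, s₂] + ρ(s₁)(f) s₂`. -/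
structure LieAlgebroid [IsManifold (𝓡 n) ∞ M] where
  /-- The anchor map. -/
  anchor : Cₛ^∞⟮𝓡 n; F →L[ℝ] EuclideanSpace ℝ (Fin n), fun x : M ↦ E x →L[ℝ] TangentSpace (𝓡 n) x⟯
  /-- The bracket, as a real bilinear map. -/
  bracket : Sec (n := n) F E →ₗ[ℝ] Sec (n := n) F E →ₗ[ℝ] Sec (n := n) F E
  bracket_self : ∀ s, bracket s s = 0
  jacobi : ∀ s₁ s₂ s₃, bracket s₁ (bracket s₂ s₃) + bracket s₂ (bracket s₃ s₁) +
    bracket s₃ (bracket s₁ s₂) = 0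
  leibniz : ∀ (s₁ s₂ : Sec (n := n) F E) (f : C^∞⟮𝓡 n, M; ℝ⟯) (x : M),
    bracket s₁ (funSMul f s₂) x =
      f x • bracket s₁ s₂ x + dirDeriv f x (anchor x (s₁ x)) • s₂ x

variable {F E} in
/-- An almost contact structure `(φ, ξ, η)` on the Lie algebroid `L` with underlying vector bundle
`E`: a smooth section `φ` of `End(E)`, a smooth section `ξ` of `E` and a smooth section `η` of `E*`
with `φ² = -id + η ⊗ ξ` and `η(ξ) = 1`. -/
structure AlmostContactStructure [IsManifold (𝓡 n) ∞ M]
    [∀ x, IsTopologicalAddGroup (E x)] [∀ x, ContinuousSMul ℝ (E x)]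
    (L : LieAlgebroid (n := n) F E) where
  /-- The `(1,1)`-tensor section. -/
  φ : Cₛ^∞⟮𝓡 n; F →L[ℝ] F, fun x : M ↦ E x →L[ℝ] E x⟯
  /-- The Reeb section. -/
  ξ : Sec (n := n) F E
  /-- The 1-form section. -/
  η : Cₛ^∞⟮𝓡 n; F →L[ℝ] ℝ, fun x : M ↦ E x →L[ℝ] Bundle.Trivial M ℝ x⟯
  φ_sq : ∀ (x : M) (v : E x), φ x (φ x v) = -v + (η x v : ℝ) • ξ x
  η_ξ : ∀ x : M, (η x (ξ x) : ℝ) = 1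

/-- A smooth local frame of `E` indexed by `ι` over an open subset of `M`; equivalently, a smooth
local trivialization of `E` with typical fibre `ℝ^ι`. -/
structure LocalFrame (ι : Type) where
  /-- The open set over which the frame is defined. -/
  domain : TopologicalSpace.Opens M
  /-- The sections of the frame (their values outside `domain` are irrelevant). -/
  sec : ι → (x : M) → E x
  isLocalFrameOn : IsLocalFrameOn (𝓡 n) F ∞ sec (domain : Set M)

/-- The structure group of `E` reduces to the subgroup `G` of `GL(ι, ℝ)`: there is a family of
smooth local frames whose domains cover `M`, any two of which are related, at each point of the
intersection of their domains, by a matrix in `G`. -/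
def StructureGroupReducesTo {ι : Type} [Fintype ι] [DecidableEq ι] (G : Subgroup (GL ι ℝ)) : Prop :=
  ∃ 𝒜 : Set (LocalFrame (n := n) F E ι),
    (∀ x : M, ∃ s ∈ 𝒜, x ∈ s.domain) ∧
    ∀ s ∈ 𝒜, ∀ t ∈ 𝒜, ∀ x : M, x ∈ s.domain → x ∈ t.domain →
      ∃ g ∈ G, ∀ j, t.sec j x = ∑ i, (g : Matrix ι ι ℝ) i j • s.sec i x

end Bundles

section Group

/-- The index type of size `2m+1`: two blocks of size `m` followed by a single index. -/
abbrev Idx (m : ℕ) : Type := (Fin m ⊕ Fin m) ⊕ Unit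

/-- The real `2m × 2m` matrix `(A, -B; B, A)` of the complex matrix `A + iB`. -/
def realForm {m : ℕ} (W : Matrix (Fin m) (Fin m) ℂ) :
    Matrix (Fin m ⊕ Fin m) (Fin m ⊕ Fin m) ℝ :=
  Matrix.fromBlocks (W.map Complex.re) (-W.map Complex.im) (W.map Complex.im) (W.map Complex.re)

theorem realForm_one {m : ℕ} : realForm (1 : Matrix (Fin m) (Fin m) ℂ) = 1 := by
  rw [realForm, ← Matrix.fromBlocks_one]
  congr 1 <;> ext i j <;> simp [Matrix.one_apply, apply_ite]

theorem realForm_mul {m : ℕ} (W Z : Matrix (Fin m) (Fin m) ℂ) :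
    realForm (W * Z) = realForm W * realForm Z := by
  simp only [realForm, Matrix.fromBlocks_multiply]
  congr 1 <;> ext i j <;>
    simp [Matrix.mul_apply, Finset.sum_add_distrib, Finset.sum_neg_distrib, sub_eq_add_neg,
      add_comm]

/-- The embedding of `U(m)` in the real `(2m+1) × (2m+1)` matrices that sends `W` to the block
diagonal matrix with blocks the real form of `W` and `1`. -/
def unitaryEmbedding (m : ℕ) :
    Matrix.unitaryGroup (Fin m) ℂ →* Matrix (Idx m) (Idx m) ℝ where
  toFun W := Matrix.fromBlocks (realForm (W : Matrix (Fin m) (Fin m) ℂ)) 0 0 1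
  map_one' := by
    simp [realForm_one, Matrix.fromBlocks_one]
  map_mul' W Z := by
    simp [realForm_mul, Matrix.fromBlocks_multiply]

/-- The subgroup `U(m) × 1` of `GL(2m+1, ℝ)`. -/
def unitaryTimesOne (m : ℕ) : Subgroup (GL (Idx m) ℝ) :=
  (unitaryEmbedding m).toHomUnits.range

end Group

end LieAlgd

end

/-! Forward: average an arbitrary fibre metric (`exists_fibre_metric`) to get one with h(φu, φv) =
h(u, v) - η(u)η(v). Then φ is skew, ξ is a unit vector dual to η, and φ is a complex structure on
ker η. Gram-Schmidt with vectors added in pairs u, φu gives local orthonormal frames (u_i, φu_i, ξ)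
(`SmoothContactMetric.exists_unitary`). The matrix between two of them fixes ξ and is unitary on ker
η (`ContactMetric.IsUnitary.exists_transition`).

Converse: the last basis vector, the last coordinate and the matrix of multiplication by i are
invariant under U(m) × 1. Read in the frames of the reduction, they glue to ξ, η and φ, and the
identities hold because they hold for the matrices. -/

set_option linter.unusedSectionVars false

noncomputable section

namespace LieAlgd

/-! ### Bump functions subordinate to an open cover -/

section Bump

/-- On a paracompact Hausdorff manifold (not necessarily `σ`-compact), every open cover indexed by
the points of the manifold admits a subordinate locally finite family of nonnegative smooth functions
without common zeros. -/
theorem exists_locallyFinite_smooth_family {n : ℕ} {M : Type*} [TopologicalSpace M] [T2Space M]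
    [ParacompactSpace M] [ChartedSpace (EuclideanSpace ℝ (Fin n)) M] [IsManifold (𝓡 n) ∞ M]
    (U : M → Set M) (hU : ∀ x, IsOpen (U x)) (hxU : ∀ x, x ∈ U x) :
    ∃ f : M → M → ℝ, (∀ i, ContMDiff (𝓡 n) 𝓘(ℝ, ℝ) ∞ (f i)) ∧
      LocallyFinite (fun i ↦ Function.support (f i)) ∧ (∀ i x, 0 ≤ f i x) ∧
      (∀ i, tsupport (f i) ⊆ U i) ∧ ∀ x, ∃ i, 0 < f i x := by
  classical
  let c : M → OpenPartialHomeomorph M (EuclideanSpace ℝ (Fin n)) := chartAt _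
  obtain ⟨V, hVo, hVc, hVf, hVU⟩ := precise_refinement (fun i ↦ U i ∩ (c i).source)
    (fun i ↦ (hU i).inter (c i).open_source)
    (Set.eq_univ_of_forall fun x ↦ Set.mem_iUnion.2 ⟨x, hxU x, mem_chart_source _ x⟩)
  -- A second shrinking puts the closure of `W i` inside the chart domain, so that a function with
  -- support `W i` is still smooth after extension by zero.
  obtain ⟨W, hWc, hWo, hWV⟩ := exists_iUnion_eq_closure_subset hVo (fun x ↦ hVf.point_finite x) hVc
  have hg (i : M) : ∃ g : EuclideanSpace ℝ (Fin n) → ℝ,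
      g.support = (c i).target ∩ (c i).symm ⁻¹' W i ∧ ContDiff ℝ ∞ g ∧
        Set.range g ⊆ Set.Icc 0 1 :=
    ((c i).isOpen_inter_preimage_symm (hWo i)).exists_contDiff_support_eq
  choose g hgs hgd hgr using hg
  let f (i x : M) : ℝ := if x ∈ (c i).source then g i (c i x) else 0
  have hWs (i) : closure (W i) ⊆ (c i).source := fun x hx ↦ (hVU i (hWV i hx)).2
  have hs (i) : Function.support (f i) = W i := by
    ext x
    by_cases hx : x ∈ (c i).source
    · have : c i x ∈ Function.support (g i) ↔ x ∈ W i := by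
        rw [hgs i]
        simp [hx]
      simpa [f, hx] using this
    · have : x ∉ W i := fun h ↦ hx (hWs i (subset_closure h))
      simp [f, hx, this]
  have hts (i) : tsupport (f i) = closure (W i) := by rw [tsupport, hs]
  have h0 (i x) : 0 ≤ f i x := by
    by_cases hx : x ∈ (c i).source
    · simpa [f, hx] using (hgr i (Set.mem_range_self _)).1
    · simp [f, hx]
  refine ⟨f, fun i ↦ contMDiff_of_tsupport fun x hx ↦ ?_, ?_, h0, fun i x hx ↦ ?_, fun x ↦ ?_⟩
  · have hx : x ∈ (c i).source := hWs i (hts i ▸ hx)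
    have : ContMDiffAt (𝓡 n) 𝓘(ℝ, ℝ) ∞ (fun y ↦ g i (c i y)) x :=
      (hgd i).contDiffAt.comp_contMDiffAt (contMDiffAt_of_mem_maximalAtlas
        (IsManifold.chart_mem_maximalAtlas i) hx)
    refine this.congr_of_eventuallyEq ?_
    filter_upwards [(c i).open_source.mem_nhds hx] with y hy
    simp [f, hy]
  · simp_rw [hs]
    exact hVf.subset fun i ↦ subset_closure.trans (hWV i)
  · exact (hVU i (hWV i (hts i ▸ hx))).1
  · obtain ⟨i, hi⟩ := Set.mem_iUnion.1 (hWc ▸ Set.mem_univ x)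
    exact ⟨i, lt_of_le_of_ne (h0 i x) (Ne.symm (show x ∈ Function.support (f i) from hs i ▸ hi))⟩

end Bump

/-! ### Smooth sections, homomorphisms and fibre metrics -/

section VectorBundles

variable {n : ℕ} {M : Type*} [TopologicalSpace M] [ChartedSpace (EuclideanSpace ℝ (Fin n)) M]
  {F : Type*} [NormedAddCommGroup F] [NormedSpace ℝ F]
  {E : M → Type*} [TopologicalSpace (Bundle.TotalSpace F E)]
  [∀ x, AddCommGroup (E x)] [∀ x, Module ℝ (E x)] [∀ x, TopologicalSpace (E x)]
  [FiberBundle F E] [VectorBundle ℝ F E]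

open Bundle Filter Topology

variable (F) in
/-- Smoothness at a point of a (not necessarily continuous) section of `E`. -/
abbrev SmoothAt (s : (x : M) → E x) (x : M) : Prop :=
  ContMDiffAt (𝓡 n) ((𝓡 n).prod 𝓘(ℝ, F)) ∞ (fun y ↦ TotalSpace.mk' F y (s y)) x

variable (F) in
/-- Every vector of a fibre extends to a section that is smooth on a neighbourhood. -/
theorem exists_smooth_extension [ContMDiffVectorBundle ∞ F E (𝓡 n)] (x : M) (v : E x) :
    ∃ (s : (y : M) → E y) (U : Set M), IsOpen U ∧ x ∈ U ∧ s x = v ∧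
      ∀ y ∈ U, SmoothAt (n := n) F s y := by
  let e := trivializationAt F E x
  have hx : x ∈ e.baseSet := FiberBundle.mem_baseSet_trivializationAt F E x
  refine ⟨fun y ↦ e.symm y (e ⟨x, v⟩).2, e.baseSet, e.open_baseSet, hx, ?_, fun y hy ↦ ?_⟩
  · exact e.symm_apply_apply_mk hx v
  · rw [SmoothAt, e.contMDiffAt_section_iff hy]
    refine (contMDiffAt_const (c := (e ⟨x, v⟩).2)).congr_of_eventuallyEq ?_
    filter_upwards [e.open_baseSet.mem_nhds hy] with z hz
    rw [e.apply_mk_symm hz]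

/-- The coefficients of a smooth section in a smooth local frame are smooth. -/
theorem contMDiffAt_frame_coeff [ContMDiffVectorBundle ∞ F E (𝓡 n)] {ι : Type*} [Fintype ι]
    {s : ι → (x : M) → E x} {U : Set M} (hs : IsLocalFrameOn (𝓡 n) F ∞ s U) (hU : IsOpen U)
    {x : M} (hx : x ∈ U) {t : (x : M) → E x} (ht : SmoothAt (n := n) F t x) (i : ι) :
    ContMDiffAt (𝓡 n) 𝓘(ℝ, ℝ) ∞ (fun y ↦ hs.coeff i y (t y)) x := by
  classical
  let e := trivializationAt F E x
  have hxe : x ∈ e.baseSet := FiberBundle.mem_baseSet_trivializationAt F E x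
  -- `A y` is the frame at `y` read in the trivialization. The coefficients of `t` are its inverse
  -- applied to `t`, and inversion is smooth at invertible maps.
  let A (y : M) : (ι → ℝ) →L[ℝ] F :=
    ∑ j, (ContinuousLinearMap.proj (R := ℝ) (φ := fun _ : ι ↦ ℝ) j).smulRight (e ⟨y, s j y⟩).2
  have hA : ContMDiffAt (𝓡 n) 𝓘(ℝ, (ι → ℝ) →L[ℝ] F) ∞ A x := by
    have h (j : ι) : ContMDiffAt (𝓡 n) 𝓘(ℝ, (ι → ℝ) →L[ℝ] F) ∞ (fun y ↦
        (ContinuousLinearMap.proj (R := ℝ) (φ := fun _ : ι ↦ ℝ) j).smulRight (e ⟨y, s j y⟩).2) x :=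
      (ContinuousLinearMap.smulRightL ℝ (ι → ℝ) F
        (ContinuousLinearMap.proj (R := ℝ) (φ := fun _ : ι ↦ ℝ) j)).contDiff.contDiffAt.comp_contMDiffAt
        ((e.contMDiffAt_section_iff hxe).1 (hs.contMDiffAt hU hx j))
    exact contMDiffAt_finsetSum (t := Finset.univ) fun j _ ↦ h j
  have hAe {y : M} (hy : y ∈ U) (hye : y ∈ e.baseSet) :
      ∃ B : (ι → ℝ) ≃L[ℝ] F, (B : (ι → ℝ) →L[ℝ] F) = A y := by
    let B : (ι → ℝ) ≃ₗ[ℝ] F := (hs.toBasisAt hy).equivFun.symm.trans (e.linearEquivAt ℝ y hye)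
    have : FiniteDimensional ℝ F := B.finiteDimensional
    refine ⟨B.toContinuousLinearEquiv, ?_⟩
    ext c
    simp [A, B, Module.Basis.equivFun_symm_apply]
  have hc {y : M} (hy : y ∈ U) (hye : y ∈ e.baseSet) :
      (fun j ↦ hs.coeff j y (t y)) = (A y).inverse (e ⟨y, t y⟩).2 := by
    obtain ⟨B, hB⟩ := hAe hy hye
    have h1 : A y (fun j ↦ hs.coeff j y (t y)) = (e ⟨y, t y⟩).2 := by
      have h2 := congrArg (e.linearEquivAt ℝ y hye) (hs.coeff_sum_eq t hy)
      simp only [map_sum, map_smul, Trivialization.linearEquivAt_apply] at h2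
      rw [h2]
      simp [A]
    rw [← h1, ← hB, ContinuousLinearMap.inverse_equiv]
    simp
  obtain ⟨B, hB⟩ := hAe hx hxe
  have hinv : ContMDiffAt (𝓡 n) 𝓘(ℝ, F →L[ℝ] (ι → ℝ)) ∞ (fun y ↦ (A y).inverse) x := by
    exact ContDiffAt.comp_contMDiffAt (hB ▸ contDiffAt_map_inverse B) hA
  have h := hinv.clm_apply ((e.contMDiffAt_section_iff hxe).1 ht)
  have h' := contMDiffAt_pi_space.1 h i
  refine h'.congr_of_eventuallyEq ?_
  filter_upwards [hU.mem_nhds hx, e.open_baseSet.mem_nhds hxe] with y hy hye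
  exact congrFun (hc hy hye) i

variable {F' : Type*} [NormedAddCommGroup F'] [NormedSpace ℝ F']
  {E' : M → Type*} [TopologicalSpace (Bundle.TotalSpace F' E')]
  [∀ x, AddCommGroup (E' x)] [∀ x, Module ℝ (E' x)] [∀ x, TopologicalSpace (E' x)]
  [FiberBundle F' E'] [VectorBundle ℝ F' E']

/-- A section of `Hom(E, E')` is smooth if it maps smooth local sections to smooth local sections. -/
theorem contMDiffAt_hom_of_apply [FiniteDimensional ℝ F]
    [∀ x, IsTopologicalAddGroup (E' x)] [∀ x, ContinuousSMul ℝ (E' x)]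
    [ContMDiffVectorBundle ∞ F E (𝓡 n)] [ContMDiffVectorBundle ∞ F' E' (𝓡 n)]
    (φ : (x : M) → E x →L[ℝ] E' x) (x : M)
    (h : ∀ s : (x : M) → E x, SmoothAt (n := n) F s x → SmoothAt (n := n) F' (fun y ↦ φ y (s y)) x) :
    ContMDiffAt (𝓡 n) ((𝓡 n).prod 𝓘(ℝ, F →L[ℝ] F')) ∞
      (fun y ↦ TotalSpace.mk' (F →L[ℝ] F') (E := fun x ↦ E x →L[ℝ] E' x) y (φ y)) x := by
  rw [contMDiffAt_hom_bundle]
  refine ⟨contMDiffAt_id, ?_⟩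
  let e := trivializationAt F E x
  let e' := trivializationAt F' E' x
  have hx : x ∈ e.baseSet := FiberBundle.mem_baseSet_trivializationAt F E x
  have hx' : x ∈ e'.baseSet := FiberBundle.mem_baseSet_trivializationAt F' E' x
  let b := Module.finBasis ℝ F
  have key (v : F) : ContMDiffAt (𝓡 n) 𝓘(ℝ, F') ∞
      (fun y ↦ ContinuousLinearMap.inCoordinates F E F' E' x y x y (φ y) v) x := by
    have h1 : SmoothAt (n := n) F (fun y ↦ (e.symm y v : E y)) x := by
      rw [SmoothAt, e.contMDiffAt_section_iff hx]
      refine (contMDiffAt_const (c := v)).congr_of_eventuallyEq ?_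
      filter_upwards [e.open_baseSet.mem_nhds hx] with z hz
      rw [e.apply_mk_symm hz]
    refine ((e'.contMDiffAt_section_iff hx').1 (h _ h1)).congr_of_eventuallyEq ?_
    filter_upwards [e.open_baseSet.mem_nhds hx, e'.open_baseSet.mem_nhds hx'] with y hy hy'
    rw [ContinuousLinearMap.inCoordinates_eq hy hy']
    simp [e, e']
  -- In finite dimension an operator depends smoothly on its values on a basis, so `key` suffices.
  have hsum (T : F →L[ℝ] F') : T = ∑ i, ((b.coord i).toContinuousLinearMap).smulRight (T (b i)) := by
    refine ContinuousLinearMap.coe_injective (b.ext fun j ↦ ?_)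
    simp [Module.Basis.coord_apply, Finsupp.single_apply, ite_smul]
  have : ContMDiffAt (𝓡 n) 𝓘(ℝ, F →L[ℝ] F') ∞ (fun y ↦ ∑ i,
      ((b.coord i).toContinuousLinearMap).smulRight
        (ContinuousLinearMap.inCoordinates F E F' E' x y x y (φ y) (b i))) x :=
    contMDiffAt_finsetSum (t := Finset.univ) fun i _ ↦
      (ContinuousLinearMap.smulRightL ℝ F F'
        ((b.coord i).toContinuousLinearMap)).contDiff.contDiffAt.comp_contMDiffAt (key (b i))
  exact this.congr_of_eventuallyEq (.of_forall fun y ↦ hsum _)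

variable (n F) in
/-- A family of bilinear forms on the fibres of `E` is smooth if its values on smooth local sections
are smooth functions. -/
def SmoothForm (h : (x : M) → E x →ₗ[ℝ] E x →ₗ[ℝ] ℝ) : Prop :=
  ∀ (x : M) (s t : (x : M) → E x), SmoothAt (n := n) F s x → SmoothAt (n := n) F t x →
    ContMDiffAt (𝓡 n) 𝓘(ℝ, ℝ) ∞ (fun y ↦ h y (s y) (t y)) x

variable (n F E) in
/-- Existence of a smooth fibre metric on a vector bundle of finite rank. -/
theorem exists_fibre_metric [T2Space M] [ParacompactSpace M] [IsManifold (𝓡 n) ∞ M]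
    [FiniteDimensional ℝ F] [ContMDiffVectorBundle ∞ F E (𝓡 n)] :
    ∃ h : (x : M) → E x →ₗ[ℝ] E x →ₗ[ℝ] ℝ, SmoothForm n F h ∧ (∀ x u v, h x u v = h x v u) ∧
      ∀ x u, u ≠ 0 → 0 < h x u u := by
  classical
  let e (i : M) := trivializationAt F E i
  obtain ⟨f, hfs, hff, hf0, hfU, hfp⟩ := exists_locallyFinite_smooth_family (n := n)
    (fun i : M ↦ (e i).baseSet) (fun i ↦ (e i).open_baseSet)
    (fun i ↦ FiberBundle.mem_baseSet_trivializationAt F E i)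
  let b := Module.finBasis ℝ F
  let B : F →ₗ[ℝ] F →ₗ[ℝ] ℝ := ∑ k, (LinearMap.mul ℝ ℝ).compl₁₂ (b.coord k) (b.coord k)
  have hB (u v : F) : B u v = ∑ k, b.coord k u * b.coord k v := by
    simp [B, LinearMap.sum_apply]
  have hBs (u v : F) : B u v = B v u := by simp only [hB, mul_comm]
  have hB0 (u : F) : 0 ≤ B u u := by
    rw [hB]; exact Finset.sum_nonneg fun k _ ↦ mul_self_nonneg _
  have hBp (u : F) (hu : u ≠ 0) : 0 < B u u := by
    refine lt_of_le_of_ne (hB0 u) fun h ↦ hu ?_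
    rw [hB, eq_comm, Finset.sum_eq_zero_iff_of_nonneg fun k _ ↦ mul_self_nonneg _] at h
    exact b.ext_elem fun k ↦ by simpa using h k (Finset.mem_univ k)
  -- `linearMapAt` is `0` off the base set; this is harmless because `f i` vanishes there.
  let L (i x : M) : E x →ₗ[ℝ] F := (e i).linearMapAt ℝ x
  let S (x : M) : Finset M := (hff.point_finite x).toFinset
  let h (x : M) : E x →ₗ[ℝ] E x →ₗ[ℝ] ℝ := ∑ i ∈ S x, f i x • B.compl₁₂ (L i x) (L i x)
  have hh (x : M) (u v : E x) : h x u v = ∑ i ∈ S x, f i x * B (L i x u) (L i x v) := by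
    simp [h, LinearMap.sum_apply]
  refine ⟨h, fun x s t hs ht ↦ ?_, fun x u v ↦ ?_, fun x u hu ↦ ?_⟩
  -- The index set `S y` varies with `y`; as a `finsum` over all indices the sum is open to local
  -- finiteness.
  · have hfin : (fun y ↦ h y (s y) (t y)) =
        fun y ↦ ∑ᶠ i, f i y * B (L i y (s y)) (L i y (t y)) := by
      funext y
      rw [hh, finsum_eq_sum_of_support_subset]
      intro i hi
      simp only [Function.mem_support, ne_eq, mul_eq_zero, not_or] at hi
      simpa [S] using hi.1
    rw [hfin]
    refine contMDiffAt_finsum (hff.subset fun i y hy ↦ ?_) fun i ↦ ?_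
    · simp only [Function.mem_support, ne_eq, mul_eq_zero, not_or] at hy
      exact hy.1
    · by_cases hx : x ∈ tsupport (f i)
      · have hxe := hfU i hx
        have hL {s : (x : M) → E x} (hs : SmoothAt (n := n) F s x) :
            ContMDiffAt (𝓡 n) 𝓘(ℝ, F) ∞ (fun y ↦ L i y (s y)) x := by
          refine (((e i).contMDiffAt_section_iff hxe).1 hs).congr_of_eventuallyEq ?_
          filter_upwards [(e i).open_baseSet.mem_nhds hxe] with y hy
          exact congrFun ((e i).coe_linearMapAt_of_mem (R := ℝ) hy) _
        refine (hfs i).contMDiffAt.mul ?_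
        simp only [hB]
        exact contMDiffAt_finsetSum (t := Finset.univ) fun k _ ↦
          ((b.coord k).toContinuousLinearMap.contDiff.contDiffAt.comp_contMDiffAt (hL hs)).mul
          ((b.coord k).toContinuousLinearMap.contDiff.contDiffAt.comp_contMDiffAt (hL ht))
      · refine (contMDiffAt_const (c := (0 : ℝ))).congr_of_eventuallyEq ?_
        filter_upwards [(isClosed_tsupport (f i)).isOpen_compl.mem_nhds hx] with y hy
        rw [image_eq_zero_of_notMem_tsupport hy, zero_mul]
  · simp only [hh, hBs]
  · rw [hh]
    obtain ⟨i, hi⟩ := hfp x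
    refine Finset.sum_pos' (fun j _ ↦ mul_nonneg (hf0 j x) (hB0 _)) ⟨i, ?_, ?_⟩
    · simpa [S] using hi.ne'
    · have hx : x ∈ (e i).baseSet := hfU i (subset_tsupport _ hi.ne')
      refine mul_pos hi (hBp _ fun h0 ↦ hu ?_)
      have h0' : (e i).linearEquivAt ℝ x hx u = 0 := by
        rw [← h0]
        exact (congrFun ((e i).coe_linearMapAt_of_mem (R := ℝ) hx) u).symm
      exact (LinearEquiv.map_eq_zero_iff _).1 h0'

end VectorBundles

/-! ### Almost contact metric structures on a vector space -/

section LinearAlgebra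

/-- An almost contact metric structure on a real vector space. -/
structure ContactMetric (V : Type*) [AddCommGroup V] [Module ℝ V] where
  /-- The endomorphism. -/
  φ : V →ₗ[ℝ] V
  /-- The Reeb vector. -/
  ξ : V
  /-- The 1-form. -/
  η : V →ₗ[ℝ] ℝ
  /-- The compatible inner product. -/
  h : V →ₗ[ℝ] V →ₗ[ℝ] ℝ
  φ_sq : ∀ v, φ (φ v) = -v + η v • ξ
  η_ξ : η ξ = 1
  symm : ∀ u v, h u v = h v u
  pos : ∀ u, u ≠ 0 → 0 < h u u
  compat : ∀ u v, h (φ u) (φ v) = h u v - η u * η v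

variable {V : Type*} [AddCommGroup V] [Module ℝ V]

/-- In an almost contact structure, the endomorphism kills the Reeb vector. -/
theorem endo_reeb {φ : V →ₗ[ℝ] V} {ξ : V} {η : V →ₗ[ℝ] ℝ} (hφ : ∀ v, φ (φ v) = -v + η v • ξ)
    (hη : η ξ = 1) : φ ξ = 0 := by
  have h0 : φ (φ ξ) = 0 := by simp [hφ, hη]
  -- φξ = cξ follows from φ²(φξ) = φ(φ²ξ) = 0. Then c²ξ = φ²ξ = 0 forces c = 0.
  have h1 : φ ξ = η (φ ξ) • ξ := by
    have := hφ (φ ξ)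
    rw [h0, map_zero] at this
    exact (neg_add_eq_zero.1 this.symm)
  have h2 : η (φ ξ) * η (φ ξ) = 0 := by
    have : φ (φ ξ) = (η (φ ξ) * η (φ ξ)) • ξ := by
      -- Otherwise rewriting with `h1` would also hit the φξ inside the coefficient.
      generalize η (φ ξ) = c at h1 ⊢
      rw [h1, map_smul, h1, smul_smul]
    rw [h0] at this
    simpa [hη] using (congrArg η this).symm
  rw [h1, mul_self_eq_zero.1 h2, zero_smul]

/-- In an almost contact structure, the 1-form kills the image of the endomorphism. -/
theorem form_endo {φ : V →ₗ[ℝ] V} {ξ : V} {η : V →ₗ[ℝ] ℝ} (hφ : ∀ v, φ (φ v) = -v + η v • ξ)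
    (hη : η ξ = 1) (v : V) : η (φ v) = 0 := by
  -- Compare the two expressions for φ³v, as φ²(φv) and φ(φ²v).
  have h1 := hφ (φ v)
  rw [hφ v, map_add, map_neg, map_smul, endo_reeb hφ hη, smul_zero, add_zero] at h1
  have h2 : η (φ v) • ξ = 0 := by simpa using h1
  simpa [hη] using congrArg η h2

/-- The compatible inner product obtained by averaging an arbitrary one. -/
def compatibleForm (φ : V →ₗ[ℝ] V) (η : V →ₗ[ℝ] ℝ) (h : V →ₗ[ℝ] V →ₗ[ℝ] ℝ) :
    V →ₗ[ℝ] V →ₗ[ℝ] ℝ :=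
  h.compl₁₂ (φ ∘ₗ φ) (φ ∘ₗ φ) + h.compl₁₂ φ φ + (LinearMap.mul ℝ ℝ).compl₁₂ η η

theorem compatibleForm_apply (φ : V →ₗ[ℝ] V) (η : V →ₗ[ℝ] ℝ) (h : V →ₗ[ℝ] V →ₗ[ℝ] ℝ) (u v : V) :
    compatibleForm φ η h u v = h (φ (φ u)) (φ (φ v)) + h (φ u) (φ v) + η u * η v := by
  simp [compatibleForm]

/-- An almost contact structure with an inner product gives an almost contact metric structure. -/
def ContactMetric.ofInner (φ : V →ₗ[ℝ] V) (ξ : V) (η : V →ₗ[ℝ] ℝ) (h : V →ₗ[ℝ] V →ₗ[ℝ] ℝ)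
    (hφ : ∀ v, φ (φ v) = -v + η v • ξ) (hη : η ξ = 1) (hs : ∀ u v, h u v = h v u)
    (hp : ∀ u, u ≠ 0 → 0 < h u u) : ContactMetric V where
  φ := φ
  ξ := ξ
  η := η
  h := compatibleForm φ η h
  φ_sq := hφ
  η_ξ := hη
  symm u v := by simp only [compatibleForm_apply, hs, mul_comm]
  pos u hu := by
    have h0 (v : V) : 0 ≤ h v v := by
      rcases eq_or_ne v 0 with rfl | hv
      · simp
      · exact (hp v hv).le
    rw [compatibleForm_apply]
    -- If φ²u = 0 then u = η(u)ξ, and the term η(u)² is positive.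
    by_cases h1 : φ (φ u) = 0
    · have h2 : η u ≠ 0 := fun h2 ↦ hu (by simpa [h1, h2] using hφ u)
      have := mul_self_pos.2 h2
      linarith [h0 (φ (φ u)), h0 (φ u)]
    · linarith [hp _ h1, h0 (φ u), mul_self_nonneg (η u)]
  compat u v := by
    -- By φ³ = -φ, replacing u, v by φu, φv swaps the first two terms of the form, and η ∘ φ = 0
    -- kills the third.
    have h3 (w : V) : φ (φ (φ w)) = -φ w := by
      rw [hφ, form_endo hφ hη]; simp
    simp only [compatibleForm_apply, form_endo hφ hη, h3, map_neg, LinearMap.neg_apply]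
    ring

namespace ContactMetric

variable (C : ContactMetric V)

theorem φ_ξ : C.φ C.ξ = 0 := endo_reeb C.φ_sq C.η_ξ

theorem η_φ (v : V) : C.η (C.φ v) = 0 := form_endo C.φ_sq C.η_ξ v

theorem h_ξ (u : V) : C.h u C.ξ = C.η u := by
  have := C.compat u C.ξ
  rw [φ_ξ, map_zero, η_ξ] at this
  linarith

/-- Apply compatibility to φu and v, then use φ²u = -u + η(u)ξ and the orthogonality of ξ to the
image of φ. -/
theorem skew (u v : V) : C.h (C.φ u) v = -C.h u (C.φ v) := by
  have := C.compat (C.φ u) v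
  rw [φ_sq, η_φ, zero_mul, sub_zero] at this
  rw [← this, map_add, LinearMap.add_apply, map_smul, LinearMap.smul_apply, C.symm C.ξ, h_ξ, η_φ]
  simp

/-- The family consisting of the `u i`, the `φ (u i)` and the Reeb vector. -/
def frame {k : ℕ} (u : Fin k → V) : Idx k → V :=
  Sum.elim (Sum.elim u fun i ↦ C.φ (u i)) fun _ ↦ C.ξ

/-- The `u i` are unitary: together with the `φ (u i)` and the Reeb vector they are orthonormal. -/
def IsUnitary {k : ℕ} (u : Fin k → V) : Prop :=
  ∀ a b : Idx k, C.h (C.frame u a) (C.frame u b) = if a = b then 1 else 0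

variable {C}

/-- The remaining entries of the Gram matrix follow from compatibility, skewness and `h_ξ`. -/
theorem isUnitary_iff {k : ℕ} {u : Fin k → V} :
    C.IsUnitary u ↔ (∀ i j, C.h (u i) (u j) = if i = j then 1 else 0) ∧
      (∀ i j, C.h (u i) (C.φ (u j)) = 0) ∧ ∀ i, C.η (u i) = 0 := by
  refine ⟨fun h ↦ ⟨fun i j ↦ ?_, fun i j ↦ ?_, fun i ↦ ?_⟩, fun ⟨h1, h2, h3⟩ ↦ ?_⟩
  · simpa [frame] using h (.inl (.inl i)) (.inl (.inl j))
  · simpa [frame] using h (.inl (.inl i)) (.inl (.inr j))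
  · simpa [frame, h_ξ] using h (.inl (.inl i)) (.inr ())
  · rintro ((i | i) | i) ((j | j) | j) <;>
      simp [frame, h1, h2, h3, C.compat, C.h_ξ, C.skew, C.η_φ, C.η_ξ, C.symm C.ξ]

theorem IsUnitary.linearIndependent {k : ℕ} {u : Fin k → V} (hu : C.IsUnitary u) :
    LinearIndependent ℝ (C.frame u) := by
  rw [Fintype.linearIndependent_iff]
  intro g hg a
  have := congrArg (fun v ↦ C.h v (C.frame u a)) hg
  simpa [LinearMap.sum_apply, hu _ a, -Fintype.sum_sum_type] using this

theorem IsUnitary.span {m : ℕ} {u : Fin m → V} (hu : C.IsUnitary u)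
    (hV : Module.finrank ℝ V = 2 * m + 1) : ⊤ ≤ Submodule.span ℝ (Set.range (C.frame u)) := by
  have hc : Fintype.card (Idx m) = Module.finrank ℝ V := by
    simp only [Fintype.card_sum, Fintype.card_fin, Fintype.card_unit, hV]; ring
  have : FiniteDimensional ℝ V := Module.finite_of_finrank_pos (by omega)
  exact (hu.linearIndependent.span_eq_top_of_card_eq_finrank' hc).ge

theorem IsUnitary.expand {m : ℕ} {u : Fin m → V} (hu : C.IsUnitary u)
    (hV : Module.finrank ℝ V = 2 * m + 1) (v : V) :
    v = ∑ a, C.h (C.frame u a) v • C.frame u a := by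
  let b := Module.Basis.mk hu.linearIndependent (hu.span hV)
  have hb (a) : b a = C.frame u a := Module.Basis.mk_apply _ _ a
  have h (a) : C.h (C.frame u a) v = b.repr v a := by
    conv_lhs => rw [← b.sum_repr v]
    simp [hb, hu a, -Fintype.sum_sum_type]
  conv_lhs => rw [← b.sum_repr v]
  simp only [h, hb]

variable (C) in
-- 2k + 1 linear forms on a space of larger dimension have a common nonzero zero.
theorem exists_orthogonal {k : ℕ} (u : Fin k → V) [FiniteDimensional ℝ V]
    (hV : 2 * k + 1 < Module.finrank ℝ V) :
    ∃ w : V, w ≠ 0 ∧ ∀ a, C.h w (C.frame u a) = 0 := by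
  let T : V →ₗ[ℝ] (Idx k → ℝ) := LinearMap.pi fun a ↦ C.h (C.frame u a)
  have hT : LinearMap.ker T ≠ ⊥ := by
    refine LinearMap.ker_ne_bot_of_finrank_lt ?_
    simp only [Module.finrank_pi, Fintype.card_sum, Fintype.card_fin, Fintype.card_unit]
    omega
  obtain ⟨w, hw, hw0⟩ := Submodule.exists_mem_ne_zero_of_ne_bot hT
  exact ⟨w, hw0, fun a ↦ (C.symm _ _).trans (congrFun (LinearMap.mem_ker.1 hw) a)⟩

/-- The component of `w` orthogonal to the family `C.frame u`. -/
def orthComp (C : ContactMetric V) {k : ℕ} (u : Fin k → V) (w : V) : V :=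
  w - ∑ a, C.h w (C.frame u a) • C.frame u a

theorem IsUnitary.orthComp_orthogonal {k : ℕ} {u : Fin k → V} (hu : C.IsUnitary u) (w : V)
    (a : Idx k) : C.h (C.orthComp u w) (C.frame u a) = 0 := by
  simp [orthComp, LinearMap.sum_apply, hu _ a, -Fintype.sum_sum_type]

/-- The conditions on φw come for free: skewness gives w ⟂ φw, and turns w ⟂ φu_i into φw ⟂ u_i. -/
theorem IsUnitary.snoc {k : ℕ} {u : Fin k → V} (hu : C.IsUnitary u) {w : V}
    (hw : ∀ a, C.h w (C.frame u a) = 0) (hn : C.h w w = 1) :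
    C.IsUnitary (Fin.snoc (α := fun _ ↦ V) u w) := by
  obtain ⟨h1, h2, h3⟩ := isUnitary_iff.1 hu
  have w1 (i) : C.h w (u i) = 0 := hw (.inl (.inl i))
  have w2 (i) : C.h w (C.φ (u i)) = 0 := hw (.inl (.inr i))
  have w3 : C.η w = 0 := (C.h_ξ w).symm.trans (hw (.inr ()))
  have w4 : C.h w (C.φ w) = 0 := by
    have := C.skew w w
    rw [C.symm] at this
    linarith
  have w5 (i) : C.h (u i) (C.φ w) = 0 := by
    rw [← neg_eq_zero, ← C.skew, C.symm, w2]
  refine isUnitary_iff.2 ⟨fun i j ↦ ?_, fun i j ↦ ?_, fun i ↦ ?_⟩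
  · refine Fin.lastCases ?_ (fun i ↦ ?_) i <;> refine Fin.lastCases ?_ (fun j ↦ ?_) j <;>
      simp [h1, w1, hn, C.symm (u _) w, Fin.castSucc_ne_last, (Fin.castSucc_ne_last _).symm]
  · refine Fin.lastCases ?_ (fun i ↦ ?_) i <;> refine Fin.lastCases ?_ (fun j ↦ ?_) j <;>
      simp [h2, w2, w4, w5]
  · refine Fin.lastCases ?_ (fun i ↦ ?_) i <;> simp [h3, w3]

/-- Two unitary frames are related by a matrix in `U(m) × 1`. -/
theorem IsUnitary.exists_transition {m : ℕ} {u w : Fin m → V} (hu : C.IsUnitary u)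
    (hw : C.IsUnitary w) (hV : Module.finrank ℝ V = 2 * m + 1) :
    ∃ g ∈ unitaryTimesOne m, ∀ b, C.frame w b =
      ∑ a, (g : Matrix (Idx m) (Idx m) ℝ) a b • C.frame u a := by
  obtain ⟨h1, h2, h3⟩ := isUnitary_iff.1 hw
  -- `W` expresses the w_j in the u_i over ℂ, with i acting on ker η as φ.
  obtain ⟨W, hre, him⟩ : ∃ W : Matrix (Fin m) (Fin m) ℂ,
      (∀ i j, (W i j).re = C.h (u i) (w j)) ∧ ∀ i j, (W i j).im = C.h (C.φ (u i)) (w j) :=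
    ⟨fun i j ↦ ⟨C.h (u i) (w j), C.h (C.φ (u i)) (w j)⟩, fun _ _ ↦ rfl, fun _ _ ↦ rfl⟩
  have hexp (j) : w j = ∑ i, C.h (u i) (w j) • u i + ∑ i, C.h (C.φ (u i)) (w j) • C.φ (u i) := by
    conv_lhs => rw [hu.expand hV (w j)]
    simp [frame, Fintype.sum_sum_type, C.symm C.ξ, C.h_ξ, h3]
  have hexpφ (j) : C.φ (w j) =
      -∑ i, C.h (C.φ (u i)) (w j) • u i + ∑ i, C.h (u i) (w j) • C.φ (u i) := by
    have hu3 := (isUnitary_iff.1 hu).2.2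
    conv_lhs => rw [hexp j]
    simp [C.φ_sq, hu3, add_comm]
  have hW : W ∈ Matrix.unitaryGroup (Fin m) ℂ := by
    rw [Matrix.mem_unitaryGroup_iff']
    ext j k
    -- `e1` and `e2` are the real and imaginary parts of W*W = 1: they expand h(w_j, w_k) = δ_jk and
    -- h(φw_j, w_k) = 0.
    have e1 : ∑ i, C.h (u i) (w j) * C.h (u i) (w k) +
        ∑ i, C.h (C.φ (u i)) (w j) * C.h (C.φ (u i)) (w k) = if j = k then 1 else 0 := by
      rw [← h1 j k]
      conv_rhs => rw [hexp j]
      simp [LinearMap.sum_apply]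
    have e2 : -∑ i, C.h (C.φ (u i)) (w j) * C.h (u i) (w k) +
        ∑ i, C.h (u i) (w j) * C.h (C.φ (u i)) (w k) = 0 := by
      rw [← h2 k j, C.symm (w k)]
      conv_rhs => rw [hexpφ j]
      simp [LinearMap.sum_apply]
    apply Complex.ext
    · rw [Matrix.mul_apply, Complex.re_sum, Matrix.one_apply, apply_ite Complex.re]
      simpa [hre, him, Matrix.star_apply, Finset.sum_add_distrib] using e1
    · rw [Matrix.mul_apply, Complex.im_sum, Matrix.one_apply, apply_ite Complex.im]
      simp only [hre, him, Matrix.star_apply, RCLike.star_def, Complex.mul_im, Complex.conj_re,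
        Complex.conj_im, Finset.sum_add_distrib, neg_mul, Finset.sum_neg_distrib, Complex.zero_im,
        Complex.one_im, ite_self]
      linarith
  refine ⟨(unitaryEmbedding m).toHomUnits ⟨W, hW⟩, ⟨_, rfl⟩, ?_⟩
  rintro ((j | j) | j)
  · simpa [frame, Fintype.sum_sum_type, unitaryEmbedding, realForm, hre, him] using hexp j
  · simpa [frame, Fintype.sum_sum_type, unitaryEmbedding, realForm, hre, him] using hexpφ j
  · simp [frame, Fintype.sum_sum_type, unitaryEmbedding]

end ContactMetric

end LinearAlgebra

/-! ### Smooth unitary frames -/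

section UnitaryFrames

variable {n : ℕ} {M : Type*} [TopologicalSpace M] [ChartedSpace (EuclideanSpace ℝ (Fin n)) M]
  {F : Type*} [NormedAddCommGroup F] [NormedSpace ℝ F]
  {E : M → Type*} [TopologicalSpace (Bundle.TotalSpace F E)]
  [∀ x, AddCommGroup (E x)] [∀ x, Module ℝ (E x)] [∀ x, TopologicalSpace (E x)]
  [FiberBundle F E] [VectorBundle ℝ F E]

open Bundle Filter Topology

variable (F) in
/-- Each fibre is linearly equivalent to the typical fibre. -/
def fibreEquiv (x : M) : E x ≃L[ℝ] F :=
  (trivializationAt F E x).continuousLinearEquivAt ℝ x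
    (FiberBundle.mem_baseSet_trivializationAt F E x)

variable (n F) in
/-- A family of almost contact metric structures on the fibres of `E` is smooth if its constituents
are. -/
structure SmoothContactMetric (C : (x : M) → ContactMetric (E x)) : Prop where
  φ : ∀ (s : (x : M) → E x) (x : M), SmoothAt (n := n) F s x →
    SmoothAt (n := n) F (fun y ↦ (C y).φ (s y)) x
  ξ : ∀ x, SmoothAt (n := n) F (fun y ↦ (C y).ξ) x
  h : SmoothForm n F fun x ↦ (C x).h

theorem SmoothContactMetric.frame {C : (x : M) → ContactMetric (E x)}
    (hC : SmoothContactMetric n F C) {k : ℕ} {u : Fin k → (x : M) → E x} {x : M}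
    (hu : ∀ i, SmoothAt (n := n) F (u i) x) (a : Idx k) :
    SmoothAt (n := n) F (fun y ↦ (C y).frame (fun i ↦ u i y) a) x := by
  rcases a with (i | i) | i
  · exact hu i
  · exact hC.φ _ x (hu i)
  · exact hC.ξ x

/-- Local existence of smooth unitary frames. -/
theorem SmoothContactMetric.exists_unitary [ContMDiffVectorBundle ∞ F E (𝓡 n)] {m : ℕ}
    (hF : Module.finrank ℝ F = 2 * m + 1) {C : (x : M) → ContactMetric (E x)}
    (hC : SmoothContactMetric n F C) (x : M) {k : ℕ} (hk : k ≤ m) :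
    ∃ (u : Fin k → (x : M) → E x) (U : Set M), IsOpen U ∧ x ∈ U ∧
      (∀ y ∈ U, ∀ i, SmoothAt (n := n) F (u i) y) ∧
      ∀ y ∈ U, (C y).IsUnitary fun i ↦ u i y := by
  induction k with
  | zero =>
    exact ⟨fun i ↦ i.elim0, Set.univ, isOpen_univ, trivial, fun _ _ i ↦ i.elim0, fun y _ ↦
      ContactMetric.isUnitary_iff.2 ⟨fun i ↦ i.elim0, fun i ↦ i.elim0, fun i ↦ i.elim0⟩⟩
  | succ k ih =>
    obtain ⟨u, U, hUo, hxU, hus, huu⟩ := ih (by omega)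
    have hEF : Module.finrank ℝ (E x) = 2 * m + 1 :=
      hF ▸ (fibreEquiv F x).toLinearEquiv.finrank_eq
    have : FiniteDimensional ℝ (E x) := Module.finite_of_finrank_pos (by omega)
    obtain ⟨w, hw0, hw⟩ := (C x).exists_orthogonal (fun i ↦ u i x) (by omega)
    obtain ⟨s, V, hVo, hxV, hsx, hs⟩ := exists_smooth_extension (n := n) F x w
    -- The extension of `w` is orthogonal to the frame only at `x`, so it is projected at nearby
    -- points. The projection fixes its value `w` at `x` and hence stays nonzero near `x`.
    let p (y : M) : E y := (C y).orthComp (fun i ↦ u i y) (s y)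
    have hp (y) (hy : y ∈ U ∩ V) : SmoothAt (n := n) F p y := by
      have hfr := hC.frame (hus y hy.1)
      have hsy := hs y hy.2
      exact hsy.sub_section (.sum_section fun a _ ↦ (hC.h y _ _ hsy (hfr a)).smul_section (hfr a))
    let q (y : M) : ℝ := (C y).h (p y) (p y)
    have hq (y) (hy : y ∈ U ∩ V) : ContMDiffAt (𝓡 n) 𝓘(ℝ, ℝ) ∞ q y := hC.h y _ _ (hp y hy) (hp y hy)
    have hpx : p x = w := by simp [p, ContactMetric.orthComp, hsx, hw, -Fintype.sum_sum_type]
    have hqx : 0 < q x := by simpa only [q, hpx] using (C x).pos w hw0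
    let W : Set M := (U ∩ V) ∩ q ⁻¹' Set.Ioi 0
    have hWo : IsOpen W := ContinuousOn.isOpen_inter_preimage
      (fun y hy ↦ (hq y hy).continuousAt.continuousWithinAt) (hUo.inter hVo) isOpen_Ioi
    let r (y : M) : ℝ := (√(q y))⁻¹
    have hr (y) (hy : y ∈ W) : ContMDiffAt (𝓡 n) 𝓘(ℝ, ℝ) ∞ r y := by
      have hqy : q y ≠ 0 := ne_of_gt hy.2
      exact (((contDiffAt_id.sqrt (by simpa using hqy)).inv (by
        simpa using (Real.sqrt_pos.2 hy.2).ne') : ContDiffAt ℝ ∞ (fun t : ℝ ↦ (√t)⁻¹)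
          (q y))).comp_contMDiffAt (hq y hy.1)
    refine ⟨Fin.snoc (α := fun _ ↦ (x : M) → E x) u fun y ↦ r y • p y, W, hWo,
      ⟨⟨hxU, hxV⟩, hqx⟩, fun y hy i ↦ ?_, fun y hy ↦ ?_⟩
    · refine Fin.lastCases ?_ (fun i ↦ ?_) i
      · simp only [Fin.snoc_last]
        exact (hr y hy).smul_section (hp y hy.1)
      · simp only [Fin.snoc_castSucc]
        exact hus y hy.1.1 i
    · have hy0 : 0 < q y := hy.2
      have := (huu y hy.1.1).snoc (w := r y • p y) (fun a ↦ by
        rw [map_smul, LinearMap.smul_apply, (huu y hy.1.1).orthComp_orthogonal, smul_zero]) (by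
        have : r y * (r y * q y) = 1 := by
          rw [← mul_assoc, ← mul_inv, Real.mul_self_sqrt hy0.le, inv_mul_cancel₀ hy0.ne']
        simpa [q] using this)
      convert this using 1
      funext i
      refine Fin.lastCases ?_ (fun i ↦ ?_) i <;> simp

/-- A smooth almost contact metric structure reduces the structure group to `U(m) × 1`. -/
theorem SmoothContactMetric.structureGroupReducesTo [ContMDiffVectorBundle ∞ F E (𝓡 n)] {m : ℕ}
    (hF : Module.finrank ℝ F = 2 * m + 1) {C : (x : M) → ContactMetric (E x)}
    (hC : SmoothContactMetric n F C) :
    StructureGroupReducesTo (n := n) F E (unitaryTimesOne m) := by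
  have hE (y : M) : Module.finrank ℝ (E y) = 2 * m + 1 :=
    hF ▸ (fibreEquiv F y).toLinearEquiv.finrank_eq
  refine ⟨{s | ∃ u : Fin m → (x : M) → E x, (∀ y ∈ s.domain, (C y).IsUnitary fun i ↦ u i y) ∧
    ∀ a y, s.sec a y = (C y).frame (fun i ↦ u i y) a}, fun x ↦ ?_, ?_⟩
  · obtain ⟨u, U, hUo, hxU, hus, huu⟩ := hC.exists_unitary hF x le_rfl
    exact ⟨⟨⟨U, hUo⟩, fun a y ↦ (C y).frame (fun i ↦ u i y) a,
      { linearIndependent := fun hy ↦ (huu _ hy).linearIndependent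
        generating := fun hy ↦ (huu _ hy).span (hE _)
        contMDiffOn := fun a y hy ↦ (hC.frame (hus y hy) a).contMDiffWithinAt }⟩,
      ⟨u, huu, fun _ _ ↦ rfl⟩, hxU⟩
  · rintro s ⟨u, hu, hsu⟩ t ⟨w, hw, htw⟩ x hxs hxt
    simpa only [hsu, htw] using (hu x hxs).exists_transition (hw x hxt) (hE x)

end UnitaryFrames

/-! ### From an almost contact structure to a reduction -/

section AlmostContact

variable {n : ℕ} {M : Type*} [TopologicalSpace M] [ChartedSpace (EuclideanSpace ℝ (Fin n)) M]
  [IsManifold (𝓡 n) ∞ M]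
  {F : Type*} [NormedAddCommGroup F] [NormedSpace ℝ F]
  {E : M → Type*} [TopologicalSpace (Bundle.TotalSpace F E)]
  [∀ x, AddCommGroup (E x)] [∀ x, Module ℝ (E x)] [∀ x, TopologicalSpace (E x)]
  [∀ x, IsTopologicalAddGroup (E x)] [∀ x, ContinuousSMul ℝ (E x)]
  [FiberBundle F E] [VectorBundle ℝ F E] [ContMDiffVectorBundle ∞ F E (𝓡 n)]

open Bundle Filter Topology

/-- A section of the trivial line bundle is smooth iff it is smooth as a function. -/
theorem smoothAt_trivial_iff {f : M → ℝ} {x : M} :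
    SmoothAt (n := n) (E := Bundle.Trivial M ℝ) ℝ f x ↔ ContMDiffAt (𝓡 n) 𝓘(ℝ, ℝ) ∞ f x :=
  (trivializationAt ℝ (Bundle.Trivial M ℝ) x).contMDiffAt_section_iff
    (FiberBundle.mem_baseSet_trivializationAt ℝ (Bundle.Trivial M ℝ) x)

/-- An almost contact structure reduces the structure group to `U(m) × 1`. -/
theorem AlmostContactStructure.structureGroupReducesTo [T2Space M] [ParacompactSpace M] {m : ℕ}
    (hF : Module.finrank ℝ F = 2 * m + 1) {L : LieAlgebroid (n := n) F E}
    (A : AlmostContactStructure L) :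
    StructureGroupReducesTo (n := n) F E (unitaryTimesOne m) := by
  have : FiniteDimensional ℝ F := Module.finite_of_finrank_pos (by omega)
  obtain ⟨h, hsm, hs, hp⟩ := exists_fibre_metric n F E
  have hφ (s : (x : M) → E x) (x : M) (hs : SmoothAt (n := n) F s x) :
      SmoothAt (n := n) F (fun y ↦ A.φ y (s y)) x := A.φ.contMDiff.contMDiffAt.clm_bundle_apply hs
  have hη (s : (x : M) → E x) (x : M) (hs : SmoothAt (n := n) F s x) :
      ContMDiffAt (𝓡 n) 𝓘(ℝ, ℝ) ∞ (fun y ↦ (A.η y (s y) : ℝ)) x :=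
    smoothAt_trivial_iff.1 (A.η.contMDiff.contMDiffAt.clm_bundle_apply hs)
  let C (x : M) : ContactMetric (E x) :=
    .ofInner (A.φ x : E x →ₗ[ℝ] E x) (A.ξ x) (A.η x : E x →ₗ[ℝ] ℝ) (h x) (A.φ_sq x) (A.η_ξ x)
      (hs x) (hp x)
  refine SmoothContactMetric.structureGroupReducesTo (C := C) hF
    ⟨hφ, fun x ↦ A.ξ.contMDiff.contMDiffAt, fun x s t hs ht ↦ ?_⟩
  have h1 := hφ _ x hs
  have h2 := hφ _ x ht
  simp only [C, ContactMetric.ofInner, compatibleForm_apply]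
  exact ((hsm x _ _ (hφ _ x h1) (hφ _ x h2)).add (hsm x _ _ h1 h2)).add ((hη _ x hs).mul (hη _ x ht))

end AlmostContact

/-! ### Invariants of U(m) × 1 -/

section Matrices

/-- The matrix of the endomorphism of an almost contact structure in a unitary frame. -/
def contactMatrix (m : ℕ) : Matrix (Idx m) (Idx m) ℝ :=
  Matrix.fromBlocks (realForm (Complex.I • 1)) 0 0 0

/-- The scalar matrix i is central among complex matrices, and `realForm` is multiplicative. -/
theorem contactMatrix_comm {m : ℕ} {g : GL (Idx m) ℝ} (hg : g ∈ unitaryTimesOne m) :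
    contactMatrix m * g = g * contactMatrix m := by
  obtain ⟨W, rfl⟩ := hg
  simp [unitaryEmbedding, contactMatrix, Matrix.fromBlocks_multiply, ← realForm_mul]

/-- The last summand is the matrix of η ⊗ ξ. -/
theorem contactMatrix_sq (m : ℕ) :
    contactMatrix m * contactMatrix m = -1 + Matrix.single (.inr ()) (.inr ()) 1 := by
  rw [contactMatrix, Matrix.fromBlocks_multiply, ← realForm_mul]
  ext ((i | i) | i) ((j | j) | j) <;>
    simp [realForm, Matrix.one_apply, apply_ite]

theorem unitaryTimesOne_last_row {m : ℕ} {g : GL (Idx m) ℝ} (hg : g ∈ unitaryTimesOne m)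
    (j : Idx m) : (g : Matrix (Idx m) (Idx m) ℝ) (.inr ()) j = if j = .inr () then 1 else 0 := by
  obtain ⟨W, rfl⟩ := hg
  rcases j with (j | j) | j <;> simp [unitaryEmbedding]

theorem unitaryTimesOne_last_col {m : ℕ} {g : GL (Idx m) ℝ} (hg : g ∈ unitaryTimesOne m)
    (i : Idx m) : (g : Matrix (Idx m) (Idx m) ℝ) i (.inr ()) = if i = .inr () then 1 else 0 := by
  obtain ⟨W, rfl⟩ := hg
  rcases i with (i | i) | i <;> simp [unitaryEmbedding]

end Matrices

/-! ### From a reduction to an almost contact structure -/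

section Converse

variable {n : ℕ} {M : Type*} [TopologicalSpace M] [ChartedSpace (EuclideanSpace ℝ (Fin n)) M]
  {F : Type*} [NormedAddCommGroup F] [NormedSpace ℝ F]
  {E : M → Type*} [TopologicalSpace (Bundle.TotalSpace F E)]
  [∀ x, AddCommGroup (E x)] [∀ x, Module ℝ (E x)] [∀ x, TopologicalSpace (E x)]
  [FiberBundle F E] [VectorBundle ℝ F E]

open Bundle Filter Topology

/-- A family of local frames with transition matrices in `G`, with domains covering the base. -/
structure IsReduction {ι : Type} [Fintype ι] [DecidableEq ι] (G : Subgroup (GL ι ℝ))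
    (𝒜 : Set (LocalFrame (n := n) F E ι)) : Prop where
  cover : ∀ x : M, ∃ s ∈ 𝒜, x ∈ s.domain
  transition : ∀ s ∈ 𝒜, ∀ t ∈ 𝒜, ∀ x : M, x ∈ s.domain → x ∈ t.domain →
      ∃ g ∈ G, ∀ j, t.sec j x = ∑ i, (g : Matrix ι ι ℝ) i j • s.sec i x

variable {ι : Type} [Fintype ι] [DecidableEq ι] {G : Subgroup (GL ι ℝ)}
  {𝒜 : Set (LocalFrame (n := n) F E ι)}

/-- A vector with `G`-invariant components defines a section. -/
theorem IsReduction.exists_section (h𝒜 : IsReduction G 𝒜) (c : ι)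
    (hc : ∀ g ∈ G, ∀ i, (g : Matrix ι ι ℝ) i c = if i = c then 1 else 0) :
    ∃ ξ : (x : M) → E x, ∀ t ∈ 𝒜, ∀ x ∈ t.domain, ξ x = t.sec c x := by
  choose s hs hxs using h𝒜.cover
  refine ⟨fun x ↦ (s x).sec c x, fun t ht x hx ↦ ?_⟩
  obtain ⟨g, hg, h⟩ := h𝒜.transition _ (hs x) t ht x (hxs x) hx
  simp [h c, hc g hg]

/-- A covector with `G`-invariant components defines a section of the dual bundle. -/
theorem IsReduction.exists_form (h𝒜 : IsReduction G 𝒜) (c : ι)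
    (hc : ∀ g ∈ G, ∀ j, (g : Matrix ι ι ℝ) c j = if j = c then 1 else 0) :
    ∃ η : (x : M) → E x →ₗ[ℝ] ℝ, ∀ t ∈ 𝒜, ∀ x ∈ t.domain, ∀ j,
      η x (t.sec j x) = if j = c then 1 else 0 := by
  choose s hs hxs using h𝒜.cover
  let b (x : M) := (s x).isLocalFrameOn.toBasisAt (hxs x)
  refine ⟨fun x ↦ (b x).coord c, fun t ht x hx j ↦ ?_⟩
  obtain ⟨g, hg, h⟩ := h𝒜.transition _ (hs x) t ht x (hxs x) hx
  have hb (i) : (s x).sec i x = b x i := by simp [b]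
  simp [h j, hb, Finsupp.single_apply, hc g hg]

/-- A matrix commuting with `G` defines a section of the endomorphism bundle. -/
theorem IsReduction.exists_endomorphism (h𝒜 : IsReduction G 𝒜) (J : Matrix ι ι ℝ)
    (hJ : ∀ g ∈ G, J * (g : Matrix ι ι ℝ) = g * J) :
    ∃ φ : (x : M) → E x →ₗ[ℝ] E x, ∀ t ∈ 𝒜, ∀ x ∈ t.domain, ∀ j,
      φ x (t.sec j x) = ∑ i, J i j • t.sec i x := by
  choose s hs hxs using h𝒜.cover
  let b (x : M) := (s x).isLocalFrameOn.toBasisAt (hxs x)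
  refine ⟨fun x ↦ Matrix.toLin (b x) (b x) J, fun t ht x hx j ↦ ?_⟩
  obtain ⟨g, hg, h⟩ := h𝒜.transition _ (hs x) t ht x (hxs x) hx
  have hb (i) : (s x).sec i x = b x i := by simp [b]
  -- In the chosen basis the coefficients of the two sides are the entries of Jg and gJ.
  simp only [h, hb, map_sum, map_smul, Matrix.toLin_self, Finset.smul_sum, smul_smul]
  rw [Finset.sum_comm]
  conv_rhs => rw [Finset.sum_comm]
  refine Finset.sum_congr rfl fun k _ ↦ ?_
  rw [← Finset.sum_smul, ← Finset.sum_smul]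
  congr 1
  have := congrFun (congrFun (hJ g hg) k) j
  simp only [Matrix.mul_apply] at this
  simpa only [mul_comm] using this

/-- A fibrewise linear map is smooth if its values on smooth local frames around every point are. -/
theorem smoothAt_apply_of_frame [ContMDiffVectorBundle ∞ F E (𝓡 n)]
    {F' : Type*} [NormedAddCommGroup F'] [NormedSpace ℝ F']
    {E' : M → Type*} [TopologicalSpace (Bundle.TotalSpace F' E')]
    [∀ x, AddCommGroup (E' x)] [∀ x, Module ℝ (E' x)] [∀ x, TopologicalSpace (E' x)]
    [FiberBundle F' E'] [VectorBundle ℝ F' E']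
    (φ : (x : M) → E x →ₗ[ℝ] E' x) (t : LocalFrame (n := n) F E ι) {x : M} (hx : x ∈ t.domain)
    (h : ∀ j, SmoothAt (n := n) F' (fun y ↦ φ y (t.sec j y)) x)
    {s : (x : M) → E x} (hs : SmoothAt (n := n) F s x) :
    SmoothAt (n := n) F' (fun y ↦ φ y (s y)) x := by
  have hc := contMDiffAt_frame_coeff t.isLocalFrameOn t.domain.isOpen hx hs
  have : SmoothAt (n := n) F'
      (fun y ↦ ∑ j, t.isLocalFrameOn.coeff j y (s y) • φ y (t.sec j y)) x :=
    .sum_section fun j _ ↦ (hc j).smul_section (h j)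
  refine this.congr_of_eventuallyEq ?_
  filter_upwards [t.domain.isOpen.mem_nhds hx] with y hy
  congr 1
  conv_lhs => rw [t.isLocalFrameOn.coeff_sum_eq s hy]
  simp only [map_sum, map_smul]

/-- A reduction of the structure group to `U(m) × 1` gives an almost contact structure. -/
theorem nonempty_almostContactStructure [IsManifold (𝓡 n) ∞ M]
    [∀ x, IsTopologicalAddGroup (E x)] [∀ x, ContinuousSMul ℝ (E x)]
    [ContMDiffVectorBundle ∞ F E (𝓡 n)] [FiniteDimensional ℝ F] {m : ℕ}
    (L : LieAlgebroid (n := n) F E)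
    (h : StructureGroupReducesTo (n := n) F E (unitaryTimesOne m)) :
    Nonempty (AlmostContactStructure L) := by
  obtain ⟨𝒜, hcov, htr⟩ := h
  have h𝒜 : IsReduction (unitaryTimesOne m) 𝒜 := ⟨hcov, htr⟩
  obtain ⟨ξ, hξ⟩ := h𝒜.exists_section (.inr ()) fun _ hg ↦ unitaryTimesOne_last_col hg
  obtain ⟨η, hη⟩ := h𝒜.exists_form (.inr ()) fun _ hg ↦ unitaryTimesOne_last_row hg
  obtain ⟨φ, hφ⟩ := h𝒜.exists_endomorphism (contactMatrix m) fun _ hg ↦ contactMatrix_comm hg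
  have hE (x : M) : FiniteDimensional ℝ (E x) := (fibreEquiv F x).toLinearEquiv.symm.finiteDimensional
  have hT (x : M) : T2Space (E x) := (fibreEquiv F x).toHomeomorph.symm.t2Space
  -- Fibres are finite-dimensional and Hausdorff, so linear maps on them are continuous.
  let φc (x : M) : E x →L[ℝ] E x := (φ x).toContinuousLinearMap
  let ηc (x : M) : E x →L[ℝ] Bundle.Trivial M ℝ x := LinearMap.toContinuousLinearMap (F' := ℝ) (η x)
  refine ⟨⟨⟨φc, fun x ↦ ?_⟩, ⟨ξ, fun x ↦ ?_⟩, ⟨ηc, fun x ↦ ?_⟩, fun x v ↦ ?_, fun x ↦ ?_⟩⟩ <;>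
    obtain ⟨t, ht, hx⟩ := hcov x
  · refine contMDiffAt_hom_of_apply φc x fun s hs ↦
      smoothAt_apply_of_frame φ t hx (fun j ↦ ?_) hs
    have : SmoothAt (n := n) F (fun y ↦ ∑ i, contactMatrix m i j • t.sec i y) x :=
      .sum_section fun i _ ↦
        contMDiffAt_const.smul_section (t.isLocalFrameOn.contMDiffAt t.domain.isOpen hx i)
    refine this.congr_of_eventuallyEq ?_
    filter_upwards [t.domain.isOpen.mem_nhds hx] with y hy
    rw [hφ t ht y hy]
  · refine (t.isLocalFrameOn.contMDiffAt t.domain.isOpen hx (.inr ())).congr_of_eventuallyEq ?_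
    filter_upwards [t.domain.isOpen.mem_nhds hx] with y hy
    rw [hξ t ht y hy]
  · refine contMDiffAt_hom_of_apply ηc x fun s hs ↦
      smoothAt_apply_of_frame (E' := Bundle.Trivial M ℝ) η t hx (fun j ↦ ?_) hs
    refine smoothAt_trivial_iff.2
      ((contMDiffAt_const (c := if j = .inr () then 1 else 0)).congr_of_eventuallyEq ?_)
    filter_upwards [t.domain.isOpen.mem_nhds hx] with y hy
    exact hη t ht y hy j
  · have : φ x ∘ₗ φ x = -LinearMap.id + (η x).smulRight (ξ x) := by
      refine (t.isLocalFrameOn.toBasisAt hx).ext fun j ↦ ?_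
      have h1 (k) := congrFun (congrFun (contactMatrix_sq m) k) j
      simp only [Matrix.mul_apply] at h1
      simp only [IsLocalFrameOn.toBasisAt_coe, LinearMap.comp_apply, LinearMap.add_apply,
        LinearMap.neg_apply, LinearMap.id_apply, LinearMap.smulRight_apply, hη t ht x hx,
        hξ t ht x hx, hφ t ht x hx, map_sum, map_smul, Finset.smul_sum, smul_smul]
      rw [Finset.sum_comm]
      simp only [← Finset.sum_smul, mul_comm (contactMatrix m _ j), h1]
      simp [Matrix.single_apply, Matrix.one_apply, add_smul, Finset.sum_add_distrib, ite_and, eq_comm,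
        -Fintype.sum_sum_type]
    exact congrArg (fun f : E x →ₗ[ℝ] E x ↦ f v) this
  · exact (congrArg (η x) (hξ t ht x hx)).trans ((hη t ht x hx _).trans (if_pos rfl))

end Converse

end LieAlgd

end

theorem theorem2p2 {n m : ℕ}
    {M : Type*} [TopologicalSpace M] [T2Space M] [ParacompactSpace M]
    [ChartedSpace (EuclideanSpace ℝ (Fin n)) M] [IsManifold (𝓡 n) ∞ M]
    {F : Type*} [NormedAddCommGroup F] [NormedSpace ℝ F]
    (hrank : Module.finrank ℝ F = 2 * m + 1)
    {E : M → Type*} [TopologicalSpace (Bundle.TotalSpace F E)]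
    [∀ x, AddCommGroup (E x)] [∀ x, Module ℝ (E x)] [∀ x, TopologicalSpace (E x)]
    [∀ x, IsTopologicalAddGroup (E x)] [∀ x, ContinuousSMul ℝ (E x)]
    [FiberBundle F E] [VectorBundle ℝ F E] [ContMDiffVectorBundle ∞ F E (𝓡 n)]
    (L : LieAlgd.LieAlgebroid (n := n) F E) :
    (LieAlgd.AlmostContactStructure L →
      LieAlgd.StructureGroupReducesTo (n := n) F E (LieAlgd.unitaryTimesOne m)) ∧
    (LieAlgd.StructureGroupReducesTo (n := n) F E (LieAlgd.unitaryTimesOne m) →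
      Nonempty (LieAlgd.AlmostContactStructure L)) := by
  -- `finrank` is `0` in infinite dimension, which the odd rank excludes.
  have : FiniteDimensional ℝ F := Module.finite_of_finrank_pos (by omega)
  exact ⟨fun A ↦ A.structureGroupReducesTo hrank,
    LieAlgd.nonempty_almostContactStructure L⟩
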